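/- Let $(X,\sigma)$ be a real vector space with a non-degenerate symplectic (alternating bilinear) form, of arbitrary dimension. Let $\mathcal W=\mathcal W(X,\sigma)$ be its Weyl algebra, i.e. a nonzero unital C*-algebra generated as a C*-algebra by unitaries $W(f)$, $f\in X$, satisfying $W(f)^*=W(-f)$ and $W(f)W(g)=e^{-\frac i2\sigma(f,g)}W(f+g)$ for all $f,g\in X$, and let $\mathcal W_0=\mathcal W_0(X,\sigma)\subset\mathcal W$ be the *-algebra generated by the Weyl elements $W(f)$. Then the following hold. 1. $\mathcal W_0$ is algebraically amenable: there is a net $(V_\lambda)$ of nonzero finite-dimensional subspaces of $\mathcal W_0$ with $\lim_\lambda \dim(AV_\lambda+V_\lambda)/\dim V_\lambda=1$ for every $A\in\mathcal W_0$. 2. The subspaces can be taken to be spans of Weyl elements over boxes. For $g=(g_1,\dots,g_n)\in X^n$ and $N\ge 1$ put $V_{g,N}=\mathrm{span}\{W(k_1g_1+\dots+k_ng_n)\mid k_1,\dots,k_n\in\{1,\dots,N\}\}$. Then $V_{g,N}$ is a nonzero finite-dimensional subspace of $\mathcal W_0$ and $\dim(W(g_i)V_{g,N}+V_{g,N})\le(1+\tfrac1N)\dim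 V_{g,N}$ for $i=1,\dots,n$. Moreover, for every finite $\mathcal F\subset\mathcal W_0$ and every $\varepsilon>0$ there are $n$, $g\in X^n$ and $N_0$ such that $\dim(AV_{g,N}+V_{g,N})\le(1+\varepsilon)\dim V_{g,N}$ for all $A\in\mathcal F$ and all $N\ge\max(N_0,1)$. 3. $\mathcal W$ is a Følner C*-algebra: there is a net of contractive completely positive maps $\varphi_\lambda\colon\mathcal W\to M_{k(\lambda)}(\mathbb C)$, $k(\lambda)\ge1$, with $\lim_\lambda\|\varphi_\lambda(AB)-\varphi_\lambda(A)\varphi_\lambda(B)\|_{2,\mathrm{tr}}=0$ and $\lim_\lambda\|\varphi_\lambda(A)\|=\|A\|$ for all $A,B\in\mathcal W$, where $\|F\|_{2,\mathrm{tr}}=\sqrt{\mathrm{tr}(F^*F)}$ and $\mathrm{tr}$ is the normalized trace. -/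

import Mathlib

open Filter Topology
open scoped CStarAlgebra ComplexOrder lp

universe u v

noncomputable section

/-- `a V + V` for an element `a` and a subspace `V` of an algebra. -/
def mulAddSubspace {A : Type v} [Ring A] [Algebra ℂ A] (a : A) (V : Submodule ℂ A) :
    Submodule ℂ A :=
  V.map (LinearMap.mulLeft ℂ a) ⊔ V

/-- Algebraic amenability of a `*`-subalgebra `S` of a C⋆-algebra: there is a net of nonzero
finite-dimensional subspaces `V i` of `S` such that `dim (a V i + V i) / dim (V i) → 1` for every
`a ∈ S`. A net is a family indexed by a nonempty directed preorder. -/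
def IsAlgebraicallyAmenable {A : Type v} [CStarAlgebra A] (S : StarSubalgebra ℂ A) : Prop :=
  ∃ (ι : Type v) (_ : Preorder ι) (_ : IsDirectedOrder ι) (_ : Nonempty ι)
    (V : ι → Submodule ℂ A),
    (∀ i, V i ≤ S.toSubalgebra.toSubmodule ∧ V i ≠ ⊥ ∧ FiniteDimensional ℂ (V i)) ∧
    ∀ a ∈ S, Tendsto
      (fun i => (Module.finrank ℂ (mulAddSubspace a (V i)) : ℝ) / Module.finrank ℂ (V i))
      atTop (𝓝 1)

/-- The norm `‖F‖_{2,tr} = √ tr(F⋆ F)` on `k × k` matrices, where `tr` is the normalized trace. -/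
def traceNorm₂ {k : ℕ} (F : CStarMatrix (Fin k) (Fin k) ℂ) : ℝ :=
  Real.sqrt ((∑ i, (star F * F) i i).re / k)

/-- Følner C⋆-algebras: there is a net of contractive completely positive maps
`φ i : A → M_{k i}(ℂ)`, `k i ≥ 1`, which is asymptotically multiplicative in `‖·‖_{2,tr}` and
asymptotically isometric for the C⋆-norms. -/
def IsFolnerCStarAlgebra (A : Type v) [NonUnitalCStarAlgebra A] [PartialOrder A]
    [StarOrderedRing A] : Prop :=
  ∃ (ι : Type v) (_ : Preorder ι) (_ : IsDirectedOrder ι) (_ : Nonempty ι)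
    (k : ι → ℕ) (φ : ∀ i, A →CP CStarMatrix (Fin (k i)) (Fin (k i)) ℂ),
    (∀ i, 0 < k i) ∧
    (∀ i a, ‖φ i a‖ ≤ ‖a‖) ∧
    (∀ a b, Tendsto (fun i => traceNorm₂ (φ i (a * b) - φ i a * φ i b)) atTop (𝓝 0)) ∧
    ∀ a, Tendsto (fun i => ‖φ i a‖) atTop (𝓝 ‖a‖)

/-- `W₀(X, σ)`: the `*`-algebra generated by the Weyl elements. -/
def weylStarAlgebra {X : Type u} {A : Type v} [CStarAlgebra A] (W : X → A) :
    StarSubalgebra ℂ A :=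
  StarAlgebra.adjoin ℂ (Set.range W)

/-- The C⋆-algebra `A` together with `W : X → A` is the Weyl algebra of `(X, σ)`: `A` is nonzero,
the `W f` are unitaries satisfying the canonical commutation relations, and they generate `A` as
a C⋆-algebra. -/
structure IsWeylAlgebra {X : Type u} [AddCommGroup X] [Module ℝ X]
    (σ : LinearMap.BilinForm ℝ X) {A : Type v} [CStarAlgebra A] (W : X → A) : Prop where
  nontrivial : Nontrivial A
  unitary : ∀ f, W f ∈ unitary A
  star_eq : ∀ f, star (W f) = W (-f)
  mul_eq : ∀ f g, W f * W g = Complex.exp (-(Complex.I / 2) * (σ f g : ℂ)) • W (f + g)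
  generates : (weylStarAlgebra W).topologicalClosure = ⊤

/-- The span of the Weyl elements `W (k₁ g₁ + ⋯ + kₙ gₙ)` with `1 ≤ kᵢ ≤ N`. -/
def weylBoxSubspace {X : Type u} [AddCommGroup X] {A : Type v} [CStarAlgebra A] (W : X → A)
    {n : ℕ} (g : Fin n → X) (N : ℕ) : Submodule ℂ A :=
  Submodule.span ℂ {a | ∃ k : Fin n → ℕ, (∀ i, 1 ≤ k i ∧ k i ≤ N) ∧ a = W (∑ i, k i • g i)}

/-! ### Existence of the Weyl algebra

The operators `(W f ψ)(h) = exp (-(i/2) σ(f, h)) ψ(h - f)` on `ℓ²(X)` generate a Weyl algebra. -/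

section Model

variable {X : Type u} [AddCommGroup X] [Module ℝ X] (σ : LinearMap.BilinForm ℝ X)

lemma norm_weylPhase (f h : X) : ‖Complex.exp (-(Complex.I / 2) * (σ f h : ℂ))‖ = 1 := by
  rw [Complex.norm_exp]; simp

lemma memℓp_weylShift (f : X) (ψ : ℓ²(X, ℂ)) :
    Memℓp (fun h => Complex.exp (-(Complex.I / 2) * (σ f h : ℂ)) * ψ (h - f)) 2 := by
  have h1 := (memℓp_gen_iff (by norm_num)).1 (lp.memℓp ψ)
  refine (memℓp_gen_iff (by norm_num)).2 ?_
  simp only [norm_mul, norm_weylPhase, one_mul]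
  exact (Equiv.subRight f).summable_iff.2 h1

/-- The Weyl operators on `ℓ²(X)`. -/
def weylModelIsometry (f : X) : ℓ²(X, ℂ) →ₗᵢ[ℂ] ℓ²(X, ℂ) where
  toFun ψ := ⟨_, memℓp_weylShift σ f ψ⟩
  map_add' a b := lp.ext (funext fun _ => mul_add _ _ _)
  map_smul' c a := lp.ext (funext fun _ => mul_left_comm _ _ _)
  norm_map' ψ := by
    rw [lp.norm_eq_tsum_rpow (by norm_num), lp.norm_eq_tsum_rpow (by norm_num)]
    congr 1
    refine (tsum_congr fun h => ?_).trans
      ((Equiv.subRight f).tsum_eq (fun h => ‖ψ h‖ ^ (2 : ENNReal).toReal))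
    change ‖Complex.exp (-(Complex.I / 2) * (σ f h : ℂ)) * ψ (h - f)‖ ^ _ = _
    rw [norm_mul, norm_weylPhase, one_mul]
    rfl

/-- The Weyl operators on `ℓ²(X)` as bounded operators. -/
def weylModelOp (f : X) : ℓ²(X, ℂ) →L[ℂ] ℓ²(X, ℂ) :=
  (weylModelIsometry σ f).toContinuousLinearMap

lemma weylModelOp_apply (f : X) (ψ : ℓ²(X, ℂ)) (h : X) :
    weylModelOp σ f ψ h = Complex.exp (-(Complex.I / 2) * (σ f h : ℂ)) * ψ (h - f) := rfl

variable {σ}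

lemma weylModelOp_mul (hσ : σ.IsAlt) (f g : X) :
    weylModelOp σ f * weylModelOp σ g =
      Complex.exp (-(Complex.I / 2) * (σ f g : ℂ)) • weylModelOp σ (f + g) := by
  refine ContinuousLinearMap.ext fun ψ => ?_
  ext h
  have e : σ f h + σ g (h - f) = σ f g + σ (f + g) h := by
    have := hσ.neg_eq f g
    simp only [map_sub, map_add, LinearMap.add_apply]
    linarith
  have e' : (σ f h : ℂ) + σ g (h - f) = σ f g + σ (f + g) h := by exact_mod_cast e
  change weylModelOp σ f (weylModelOp σ g ψ) h = _ * weylModelOp σ (f + g) ψ h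
  rw [weylModelOp_apply, weylModelOp_apply, weylModelOp_apply, ← mul_assoc, ← mul_assoc,
    ← Complex.exp_add, ← Complex.exp_add, ← mul_add, ← mul_add, e', sub_sub]

lemma weylModelOp_zero : weylModelOp σ 0 = 1 := by
  refine ContinuousLinearMap.ext fun ψ => ?_
  ext h
  rw [weylModelOp_apply]
  simp

lemma weylModelOp_mul_neg (hσ : σ.IsAlt) (f : X) :
    weylModelOp σ f * weylModelOp σ (-f) = 1 := by
  rw [weylModelOp_mul hσ, add_neg_cancel, weylModelOp_zero, map_neg, hσ.self_eq_zero]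
  simp

lemma weylModelOp_star_mul (f : X) : star (weylModelOp σ f) * weylModelOp σ f = 1 :=
  ContinuousLinearMap.ext fun ψ => by
    refine ext_inner_left ℂ fun χ => ?_
    change inner ℂ χ (ContinuousLinearMap.adjoint (weylModelOp σ f) (weylModelOp σ f ψ)) = _
    rw [ContinuousLinearMap.adjoint_inner_right]
    exact (weylModelIsometry σ f).inner_map_map χ ψ

lemma weylModelOp_star (hσ : σ.IsAlt) (f : X) :
    star (weylModelOp σ f) = weylModelOp σ (-f) := by
  rw [← mul_one (star _), ← weylModelOp_mul_neg hσ f, ← mul_assoc, weylModelOp_star_mul, one_mul]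

/-- A Weyl algebra exists for every symplectic vector space. -/
theorem exists_isWeylAlgebra (hσ : σ.IsAlt) :
    ∃ (A : Type u) (_ : CStarAlgebra A) (W : X → A), IsWeylAlgebra σ W := by
  let S := (weylStarAlgebra (weylModelOp σ)).topologicalClosure
  have hS : ∀ f, weylModelOp σ f ∈ S := fun f =>
    StarSubalgebra.le_topologicalClosure _ (StarAlgebra.subset_adjoin _ _ ⟨f, rfl⟩)
  have hc : IsClosed (S : Set (ℓ²(X, ℂ) →L[ℂ] ℓ²(X, ℂ))) :=
    StarSubalgebra.isClosed_topologicalClosure _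
  have : Nontrivial (ℓ²(X, ℂ)) := by
    classical
    refine ⟨lp.single 2 0 1, 0, fun h => ?_⟩
    have := congrArg (fun ψ : ℓ²(X, ℂ) => ψ 0) h
    simp at this
  have hstar : ∀ f, star (⟨weylModelOp σ f, hS f⟩ : S) = ⟨weylModelOp σ (-f), hS (-f)⟩ :=
    fun f => Subtype.ext (weylModelOp_star hσ f)
  refine ⟨S, StarSubalgebra.cstarAlgebra S, fun f => ⟨weylModelOp σ f, hS f⟩, ?_, ?_, hstar, ?_, ?_⟩
  · exact inferInstanceAs (Nontrivial S)
  · intro f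
    rw [Unitary.mem_iff, hstar]
    refine ⟨Subtype.ext ?_, Subtype.ext (weylModelOp_mul_neg hσ f)⟩
    simpa using weylModelOp_mul_neg hσ (-f)
  · exact fun f g => Subtype.ext (weylModelOp_mul hσ f g)
  · refine eq_top_iff.2 fun x _ => ?_
    have himg : (weylStarAlgebra (fun f => (⟨weylModelOp σ f, hS f⟩ : S))).map S.subtype =
        weylStarAlgebra (weylModelOp σ) := by
      rw [weylStarAlgebra, StarAlgHom.map_adjoin, weylStarAlgebra, ← Set.range_comp]
      rfl
    change x ∈ closure (weylStarAlgebra (fun f => (⟨weylModelOp σ f, hS f⟩ : S)) : Set S)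
    rw [Topology.IsInducing.subtypeVal.closure_eq_preimage_closure_image]
    have hx : (x : ℓ²(X, ℂ) →L[ℂ] ℓ²(X, ℂ)) ∈
        closure (weylStarAlgebra (weylModelOp σ) : Set (ℓ²(X, ℂ) →L[ℂ] ℓ²(X, ℂ))) := x.2
    rw [← himg] at hx
    exact hx

end Model

end

noncomputable section

/-! Up to a phase, `W f` translates labels: `W f * W y` is a multiple of `W (f + y)`. Once the Weyl
elements are known to be linearly independent, dimensions of their spans count labels, and
everything reduces to Følner sets in the additive group `X`.

Independence comes from `norm_scalar_le`: averaging an element with a conjugate by a suitable Weyl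
element removes one nonscalar term, fixes the scalar term and does not increase the norm. Hence
coefficients are bounded by the norm, and the coefficient of `1` extends to a state for which the
Weyl elements are orthonormal (`exists_state`).

The Følner sets are boxes. Translation along a side moves at most the fraction `1 / N` of a box out
of it (`mul_card_translationBoundary_le`), which gives the dimension estimates directly.

For the matrix maps, compress the GNS action of the state to the span of the Weyl elements over a
Følner set. Multiplicativity by `W f` fails only in the columns of boundary points, a vanishing
proportion. Asymptotic isometry needs no faithfulness argument: the contraction `reconstructionMap`
takes the compressions back to `A`, and the composites tend pointwise to the identity. Both limits
are checked on Weyl elements and extended by density. -/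

namespace IsWeylAlgebra

/-! ### Independence of the Weyl elements and the canonical state. -/

variable {X : Type u} [AddCommGroup X] [Module ℝ X] {σ : LinearMap.BilinForm ℝ X}
  {A : Type v} [CStarAlgebra A] {W : X → A}

lemma star_mul_self_eq (hW : IsWeylAlgebra σ W) (f : X) : star (W f) * W f = 1 :=
  (hW.unitary f).1

lemma self_mul_star_eq (hW : IsWeylAlgebra σ W) (f : X) : W f * star (W f) = 1 :=
  (hW.unitary f).2

lemma map_zero (hW : IsWeylAlgebra σ W) : W 0 = 1 := by
  have h := hW.mul_eq 0 0
  simp only [_root_.map_zero, Complex.ofReal_zero, mul_zero, Complex.exp_zero, one_smul,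
    add_zero] at h
  calc W 0 = star (W 0) * W 0 * W 0 := by rw [hW.star_mul_self_eq, one_mul]
    _ = 1 := by rw [mul_assoc, h, hW.star_mul_self_eq]

lemma conj_eq (hW : IsWeylAlgebra σ W) (hσ : σ.IsAlt) (h f : X) :
    W h * W f * star (W h) = Complex.exp (-Complex.I * (σ h f : ℂ)) • W f := by
  have e : σ (h + f) (-h) = σ h f := by
    have := hσ.neg_eq h f
    have h0 : σ h h = 0 := hσ.self_eq_zero h
    simp only [map_neg, map_add, LinearMap.add_apply, h0]
    linarith
  rw [hW.mul_eq, hW.star_eq, smul_mul_assoc, hW.mul_eq, smul_smul, ← Complex.exp_add, e,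
    add_neg_cancel_comm]
  congr 2
  ring

/-- Some Weyl element anticommutes with a given nonscalar one. -/
lemma exists_conj_eq_neg (hW : IsWeylAlgebra σ W) (hσ : σ.IsAlt) (hnd : σ.Nondegenerate)
    {f : X} (hf : f ≠ 0) : ∃ h, W h * W f * star (W h) = -W f := by
  have : ∃ h, σ h f ≠ 0 := by
    by_contra! H
    exact hf (hnd.2 f H)
  obtain ⟨h, hh⟩ := this
  -- Rescaling makes the form equal to `π`, so the conjugation phase is `exp (-iπ) = -1`.
  refine ⟨(Real.pi / σ h f) • h, ?_⟩
  rw [hW.conj_eq hσ, map_smul, LinearMap.smul_apply, smul_eq_mul, div_mul_cancel₀ _ hh,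
    neg_mul, Complex.exp_neg, mul_comm, Complex.exp_pi_mul_I]
  simp

lemma norm_weyl_mul (hW : IsWeylAlgebra σ W) (f : X) (a : A) : ‖W f * a‖ = ‖a‖ :=
  CStarRing.norm_mem_unitary_mul a (hW.unitary f)

lemma norm_conj (hW : IsWeylAlgebra σ W) (f : X) (a : A) : ‖W f * a * star (W f)‖ = ‖a‖ := by
  rw [CStarRing.norm_mul_mem_unitary _ (Unitary.star_mem (hW.unitary f)), hW.norm_weyl_mul]

/-- Conjugation by Weyl elements is isometric, fixes `1` and multiplies each `W g` by a phase.
Averaging with a conjugation that negates `W f` deletes that term and only rescales the others, so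
induction removes all of them. -/
lemma norm_scalar_le (hW : IsWeylAlgebra σ W) (hσ : σ.IsAlt) (hnd : σ.Nondegenerate)
    (s : Finset X) (h0 : 0 ∉ s) (z : ℂ) (c : X → ℂ) :
    ‖z‖ ≤ ‖z • (1 : A) + ∑ f ∈ s, c f • W f‖ := by
  classical
  have := hW.nontrivial
  induction s using Finset.induction_on generalizing c with
  | empty => simp [norm_smul]
  | insert f s hf ih =>
    rw [Finset.mem_insert, not_or] at h0
    obtain ⟨h, hh⟩ := hW.exists_conj_eq_neg hσ hnd (Ne.symm h0.1)
    set a := z • (1 : A) + ∑ g ∈ insert f s, c g • W g with ha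
    -- The new coefficients are those of the average of `a` and its conjugate by `W h`.
    refine (ih h0.2 fun g => (1 + Complex.exp (-Complex.I * (σ h g : ℂ))) / 2 * c g).trans ?_
    have key : z • (1 : A) + ∑ g ∈ s, ((1 + Complex.exp (-Complex.I * (σ h g : ℂ))) / 2 * c g) • W g
        = (1 / 2 : ℂ) • (a + W h * a * star (W h)) := by
      rw [ha, Finset.sum_insert hf]
      simp only [mul_add, add_mul, Finset.mul_sum, Finset.sum_mul, mul_smul_comm, smul_mul_assoc,
        mul_one, hW.self_mul_star_eq, hh, hW.conj_eq hσ h]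
      have e : ∀ g, ((1 + Complex.exp (-Complex.I * (σ h g : ℂ))) / 2 * c g) • W g =
          (1 / 2 : ℂ) • (c g • W g + c g • Complex.exp (-Complex.I * (σ h g : ℂ)) • W g) := by
        intro g
        module
      rw [Finset.sum_congr rfl fun g _ => e g, ← Finset.smul_sum, Finset.sum_add_distrib]
      module
    rw [key, norm_smul]
    have := norm_add_le a (W h * a * star (W h))
    rw [hW.norm_conj] at this
    norm_num
    linarith

/-- The coefficients of a combination of Weyl elements are bounded by its norm. -/
lemma norm_coeff_le (hW : IsWeylAlgebra σ W) (hσ : σ.IsAlt) (hnd : σ.Nondegenerate)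
    (s : Finset X) (c : X → ℂ) {g : X} (hg : g ∈ s) : ‖c g‖ ≤ ‖∑ f ∈ s, c f • W f‖ := by
  classical
  rw [← hW.norm_weyl_mul (-g), ← Finset.add_sum_erase s _ hg, mul_add, mul_smul_comm, ← hW.star_eq,
    hW.star_mul_self_eq, Finset.mul_sum]
  -- Multiplication by `W (-g)` shifts the labels so that `g` becomes `0`; no other label does.
  let t := (s.erase g).image fun f => -g + f
  have ht : 0 ∉ t := by
    simp only [t, Finset.mem_image, Finset.mem_erase, not_exists, not_and, and_imp]
    intro f hf _ h
    exact hf (neg_add_eq_zero.1 h).symm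
  convert hW.norm_scalar_le hσ hnd t ht (c g)
    (fun f => c (g + f) * Complex.exp (-(Complex.I / 2) * (σ (-g) (g + f) : ℂ))) using 3
  rw [Finset.sum_image (fun a _ b _ h => add_left_cancel h)]
  refine Finset.sum_congr rfl fun f _ => ?_
  rw [mul_smul_comm, hW.star_eq, hW.mul_eq, smul_smul, add_neg_cancel_left]

lemma linearIndependent (hW : IsWeylAlgebra σ W) (hσ : σ.IsAlt) (hnd : σ.Nondegenerate) :
    LinearIndependent ℂ W := by
  rw [linearIndependent_iff']
  intro s c h g hg
  simpa [h] using hW.norm_coeff_le hσ hnd s c hg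

lemma span_mul_mem (hW : IsWeylAlgebra σ W) {a b : A} (ha : a ∈ Submodule.span ℂ (Set.range W))
    (hb : b ∈ Submodule.span ℂ (Set.range W)) : a * b ∈ Submodule.span ℂ (Set.range W) := by
  have := Submodule.mul_mem_mul ha hb
  rw [Submodule.span_mul_span] at this
  refine Submodule.span_le.2 ?_ this
  rintro _ ⟨_, ⟨f, rfl⟩, _, ⟨g, rfl⟩, rfl⟩
  simp only [hW.mul_eq]
  exact Submodule.smul_mem _ _ (Submodule.subset_span ⟨_, rfl⟩)

lemma span_star_mem (hW : IsWeylAlgebra σ W) {a : A} (ha : a ∈ Submodule.span ℂ (Set.range W)) :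
    star a ∈ Submodule.span ℂ (Set.range W) := by
  induction ha using Submodule.span_induction with
  | mem x hx =>
    obtain ⟨f, rfl⟩ := hx
    rw [hW.star_eq]
    exact Submodule.subset_span ⟨_, rfl⟩
  | zero => simp
  | add x y _ _ hx hy => rw [star_add]; exact Submodule.add_mem _ hx hy
  | smul c x _ hx => rw [star_smul]; exact Submodule.smul_mem _ _ hx

/-- The commutation relations make the linear span closed under products and adjoints, and it
contains `1 = W 0`. -/
lemma weylStarAlgebra_toSubmodule (hW : IsWeylAlgebra σ W) :
    (weylStarAlgebra W).toSubalgebra.toSubmodule = Submodule.span ℂ (Set.range W) := by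
  refine le_antisymm ?_ (Submodule.span_le.2 (StarAlgebra.subset_adjoin ℂ _))
  let S : StarSubalgebra ℂ A :=
    { carrier := Submodule.span ℂ (Set.range W)
      mul_mem' := hW.span_mul_mem
      add_mem' := Submodule.add_mem _
      algebraMap_mem' := fun r => by
        rw [Algebra.algebraMap_eq_smul_one, ← hW.map_zero]
        exact Submodule.smul_mem _ _ (Submodule.subset_span ⟨0, rfl⟩)
      star_mem' := hW.span_star_mem }
  have : weylStarAlgebra W ≤ S := StarAlgebra.adjoin_le Submodule.subset_span
  exact fun x hx => this hx

lemma mem_weylStarAlgebra_iff (hW : IsWeylAlgebra σ W) {a : A} :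
    a ∈ weylStarAlgebra W ↔ a ∈ Submodule.span ℂ (Set.range W) := by
  rw [← hW.weylStarAlgebra_toSubmodule]; rfl

lemma dense_span (hW : IsWeylAlgebra σ W) :
    Dense (Submodule.span ℂ (Set.range W) : Set A) := by
  intro a
  have h : a ∈ (weylStarAlgebra W).topologicalClosure := by rw [hW.generates]; trivial
  have e : (Submodule.span ℂ (Set.range W) : Set A) = (weylStarAlgebra W : Set A) := by
    ext x; exact hW.mem_weylStarAlgebra_iff.symm
  rw [e]
  exact h

/-- The coefficient of `W 0 = 1` extends to a continuous functional on the whole algebra. -/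
lemma exists_functional (hW : IsWeylAlgebra σ W) (hσ : σ.IsAlt) (hnd : σ.Nondegenerate) :
    ∃ τ : A →L[ℂ] ℂ, τ 1 = 1 ∧ ∀ f, f ≠ 0 → τ (W f) = 0 := by
  classical
  have hli := hW.linearIndependent hσ hnd
  let φ : Submodule.span ℂ (Set.range W) →ₗ[ℂ] ℂ := (Finsupp.lapply 0) ∘ₗ hli.repr
  have hφ : ∀ x, ‖φ x‖ ≤ 1 * ‖x‖ := by
    intro x
    have hx := hli.linearCombination_repr x
    rw [Finsupp.linearCombination_apply, Finsupp.sum] at hx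
    rw [one_mul]
    change ‖hli.repr x 0‖ ≤ ‖(x : A)‖
    by_cases h0 : (0 : X) ∈ (hli.repr x).support
    · conv_rhs => rw [← hx]
      exact hW.norm_coeff_le hσ hnd _ _ h0
    · rw [Finsupp.notMem_support_iff.1 h0, norm_zero]
      exact norm_nonneg _
  obtain ⟨τ, hτ, -⟩ := exists_extension_norm_eq (𝕜 := ℂ) _ (φ.mkContinuous 1 hφ)
  have hval : ∀ f, τ (W f) = if f = 0 then 1 else 0 := by
    intro f
    have := hτ ⟨W f, Submodule.subset_span ⟨f, rfl⟩⟩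
    rw [LinearMap.mkContinuous_apply] at this
    rw [this]
    change hli.repr ⟨W f, _⟩ 0 = _
    rw [hli.repr_eq_single f _ rfl, Finsupp.single_apply]
  refine ⟨τ, ?_, fun f hf => ?_⟩
  · rw [← hW.map_zero, hval, if_pos rfl]
  · rw [hval, if_neg hf]

/-- The canonical tracial state: the Weyl elements are orthonormal for it. -/
lemma exists_state [PartialOrder A] [StarOrderedRing A] (hW : IsWeylAlgebra σ W) (hσ : σ.IsAlt)
    (hnd : σ.Nondegenerate) :
    ∃ τ : A →ₚ[ℂ] ℂ, (∀ f, τ (star (W f) * W f) = 1) ∧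
      ∀ f g, f ≠ g → τ (star (W f) * W g) = 0 := by
  classical
  obtain ⟨τ, h1, h0⟩ := hW.exists_functional hσ hnd
  have hself : ∀ f, τ (star (W f) * W f) = 1 := fun f => by rw [hW.star_mul_self_eq, h1]
  have hne : ∀ f g, f ≠ g → τ (star (W f) * W g) = 0 := by
    intro f g hfg
    rw [hW.star_eq, hW.mul_eq, map_smul, h0 _ (fun h => hfg (neg_add_eq_zero.1 h)), smul_zero]
  -- For a finite combination the value is the sum of the squared moduli of its coefficients;
  -- positivity is a closed condition, so density suffices.
  have hpos : ∀ a, 0 ≤ τ (star a * a) := by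
    intro a
    have hcl : IsClosed {a : A | 0 ≤ τ (star a * a)} :=
      isClosed_le continuous_const (by fun_prop)
    refine hcl.closure_subset_iff.2 ?_ (hW.dense_span a)
    intro b hb
    obtain ⟨c, rfl⟩ := Finsupp.mem_span_range_iff_exists_finsupp.1 hb
    rw [Set.mem_ofPred_eq, Finsupp.sum, star_sum, Finset.sum_mul_sum, map_sum]
    refine Finset.sum_nonneg fun f hf => ?_
    rw [map_sum, Finset.sum_eq_single_of_mem f hf]
    · rw [star_smul, smul_mul_smul_comm, map_smul, hself, smul_eq_mul, mul_one]
      exact star_mul_self_nonneg _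
    · intro g _ hg
      rw [star_smul, smul_mul_smul_comm, map_smul, hne f g hg.symm, smul_zero]
  refine ⟨PositiveLinearMap.mk₀ τ.toLinearMap fun a ha => ?_, hself, hne⟩
  obtain ⟨b, rfl⟩ := CStarAlgebra.nonneg_iff_eq_star_mul_self.1 ha
  exact hpos b

end IsWeylAlgebra

/-! ### Boxes as Følner sets. -/

open scoped Classical in
/-- The points of `B` which the translation by `f` moves out of `B`. -/
def translationBoundary {X : Type u} [AddCommGroup X] (f : X) (B : Finset X) : Finset X :=
  B.filter fun y => f + y ∉ B

open scoped Classical in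
/-- The set of all `k₁ g₁ + ⋯ + kₙ gₙ` with `1 ≤ kᵢ ≤ N`. -/
def boxFinset {X : Type u} [AddCommGroup X] {n : ℕ} (g : Fin n → X) (N : ℕ) : Finset X :=
  (Fintype.piFinset fun _ : Fin n => Finset.Icc 1 N).image fun k => ∑ i, k i • g i

lemma finiteDimensional_span_image {X : Type u} {A : Type v} [CStarAlgebra A] (W : X → A) (B : Finset X) :
    FiniteDimensional ℂ (Submodule.span ℂ (W '' B)) :=
  FiniteDimensional.span_of_finite ℂ (B.finite_toSet.image W)

section Box

variable {X : Type u} [AddCommGroup X] {n : ℕ}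

lemma mem_translationBoundary {f : X} {B : Finset X} {y : X} :
    y ∈ translationBoundary f B ↔ y ∈ B ∧ f + y ∉ B := by
  simp [translationBoundary]

lemma mem_boxFinset {g : Fin n → X} {N : ℕ} {x : X} :
    x ∈ boxFinset g N ↔ ∃ k : Fin n → ℕ, (∀ i, 1 ≤ k i ∧ k i ≤ N) ∧ x = ∑ i, k i • g i := by
  simp [boxFinset, eq_comm]

lemma boxFinset_nonempty (g : Fin n → X) {N : ℕ} (hN : 1 ≤ N) : (boxFinset g N).Nonempty :=
  ⟨_, mem_boxFinset.2 ⟨fun _ => 1, fun _ => ⟨le_rfl, hN⟩, rfl⟩⟩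

lemma sum_update_smul (g : Fin n → X) (k : Fin n → ℕ) (i : Fin n) (m : ℕ) :
    ∑ j, Function.update k i m j • g j + k i • g i = ∑ j, k j • g j + m • g i := by
  rw [← Finset.add_sum_erase _ _ (Finset.mem_univ i),
    ← Finset.add_sum_erase _ (fun j => k j • g j) (Finset.mem_univ i), Function.update_self]
  have : ∑ j ∈ Finset.univ.erase i, Function.update k i m j • g j =
      ∑ j ∈ Finset.univ.erase i, k j • g j :=
    Finset.sum_congr rfl fun j hj => by rw [Function.update_of_ne (Finset.ne_of_mem_erase hj)]
  rw [this]
  abel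

/-- A boundary point must have `i`-th coordinate `N`, otherwise that coordinate could be raised
inside the box. It can then be lowered `N - 1` times. The `g i` may be dependent; one choice of
coordinates is enough. -/
lemma sub_nsmul_mem_boxFinset {g : Fin n → X} {N : ℕ} {i : Fin n} {y : X}
    (hy : y ∈ translationBoundary (g i) (boxFinset g N)) {j : ℕ} (hj : j < N) :
    y - j • g i ∈ boxFinset g N := by
  obtain ⟨hyB, hyB'⟩ := mem_translationBoundary.1 hy
  obtain ⟨k, hk, rfl⟩ := mem_boxFinset.1 hyB
  have hkN : k i = N := by
    by_contra hne
    refine hyB' (mem_boxFinset.2 ⟨Function.update k i (k i + 1), fun l => ?_, ?_⟩)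
    · have := hk l
      have := hk i
      rcases eq_or_ne l i with rfl | hl
      · rw [Function.update_self]; omega
      · rwa [Function.update_of_ne hl]
    · have := sum_update_smul g k i (k i + 1)
      rw [add_smul, one_smul] at this
      rw [← add_right_cancel_iff (a := k i • g i), this]
      abel
  refine mem_boxFinset.2 ⟨Function.update k i (N - j), fun l => ?_, ?_⟩
  · rcases eq_or_ne l i with rfl | hl
    · rw [Function.update_self]; omega
    · rw [Function.update_of_ne hl]; exact hk l
  · have := sum_update_smul g k i (N - j)
    rw [← add_right_cancel_iff (a := k i • g i), this, hkN]
    have e : N • g i = (N - j) • g i + j • g i := by rw [← add_smul]; congr 1; omega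
    rw [e]
    abel

/-- A box of side `N` loses at most the proportion `1 / N` under translation along a side. -/
lemma mul_card_translationBoundary_le (g : Fin n → X) (N : ℕ) (i : Fin n) :
    N * (translationBoundary (g i) (boxFinset g N)).card ≤ (boxFinset g N).card := by
  rw [← Finset.card_range N, ← Finset.card_product, Finset.card_range]
  -- The `N` shifted copies of the boundary are disjoint: for `j < j'`, a coincidence gives `g i + y
  -- = y' - (j' - j - 1) • g i`, which lies in the box.
  have aux : ∀ {j j' : ℕ} {y y' : X}, j' < N → y ∈ translationBoundary (g i) (boxFinset g N) →
      y' ∈ translationBoundary (g i) (boxFinset g N) → y - j • g i = y' - j' • g i → ¬ j < j' := by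
    intro j j' y y' hj' hy hy' h hlt
    refine (mem_translationBoundary.1 hy).2 ?_
    have := sub_nsmul_mem_boxFinset hy' (show j' - j - 1 < N by omega)
    convert this using 1
    have e : j' • g i = (j' - j - 1) • g i + g i + j • g i := by
      rw [← succ_nsmul, ← add_smul]; congr 1; omega
    rw [e] at h
    rw [sub_eq_iff_eq_add.1 h]
    abel
  refine Finset.card_le_card_of_injOn (fun p => p.2 - p.1 • g i) ?_ ?_
  · rintro ⟨j, y⟩ hp
    rw [Finset.mem_coe, Finset.mem_product] at hp
    exact sub_nsmul_mem_boxFinset hp.2 (Finset.mem_range.1 hp.1)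
  · rintro ⟨j, y⟩ hp ⟨j', y'⟩ hp' h
    rw [Finset.mem_coe, Finset.mem_product] at hp hp'
    simp only at h hp hp'
    have h1 := aux (Finset.mem_range.1 hp'.1) hp.2 hp'.2 h
    have h2 := aux (Finset.mem_range.1 hp.1) hp'.2 hp.2 h.symm
    obtain rfl : j = j' := by omega
    rw [sub_left_inj.1 h]

lemma card_translationBoundary_le_of_mul_le {t : Finset X} {ε : ℝ} {N : ℕ} (hN : 1 ≤ N)
    (hε : 1 ≤ ε * N) {g : Fin n → X} (hg : ∀ f ∈ t, ∃ i, g i = f) {f : X} (hf : f ∈ t) :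
    ((translationBoundary f (boxFinset g N)).card : ℝ) ≤ ε * (boxFinset g N).card := by
  obtain ⟨i, rfl⟩ := hg f hf
  have h : (N : ℝ) * (translationBoundary (g i) (boxFinset g N)).card ≤ (boxFinset g N).card := by
    exact_mod_cast mul_card_translationBoundary_le g N i
  have hN' : (0 : ℝ) < N := by exact_mod_cast hN
  have hεpos : 0 ≤ ε := by
    by_contra! hlt
    nlinarith
  calc ((translationBoundary (g i) (boxFinset g N)).card : ℝ)
      ≤ ε * N * (translationBoundary (g i) (boxFinset g N)).card :=
        le_mul_of_one_le_left (Nat.cast_nonneg _) hε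
    _ = ε * (N * (translationBoundary (g i) (boxFinset g N)).card) := by ring
    _ ≤ _ := mul_le_mul_of_nonneg_left h hεpos

/-- Abelian groups satisfy the Følner condition. -/
lemma exists_folner_finset (t : Finset X) {ε : ℝ} (hε : 0 < ε) :
    ∃ B : Finset X, B.Nonempty ∧ ∀ f ∈ t, ((translationBoundary f B).card : ℝ) ≤ ε * B.card := by
  obtain ⟨N, hN⟩ := exists_nat_ge (max 1 (1 / ε))
  have hN1 : 1 ≤ N := by exact_mod_cast (le_max_left _ _).trans hN
  have hN2 : 1 ≤ ε * N := by
    have := (le_max_right _ _).trans hN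
    rwa [div_le_iff₀ hε, mul_comm] at this
  refine ⟨boxFinset (fun i => (t.equivFin.symm i : X)) N, boxFinset_nonempty _ hN1,
    fun f hf => card_translationBoundary_le_of_mul_le hN1 hN2 (fun f hf => ?_) hf⟩
  exact ⟨t.equivFin ⟨f, hf⟩, by simp⟩

lemma weylBoxSubspace_eq {A : Type v} [CStarAlgebra A] (W : X → A) (g : Fin n → X) (N : ℕ) :
    weylBoxSubspace W g N = Submodule.span ℂ (W '' boxFinset g N) := by
  rw [weylBoxSubspace]
  congr 1
  ext a
  simp only [Set.mem_ofPred_eq, Set.mem_image, Finset.mem_coe, mem_boxFinset]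
  constructor
  · rintro ⟨k, hk, rfl⟩
    exact ⟨_, ⟨k, hk, rfl⟩, rfl⟩
  · rintro ⟨_, ⟨k, hk, rfl⟩, rfl⟩
    exact ⟨k, hk, rfl⟩

lemma finiteDimensional_weylBoxSubspace {A : Type v} [CStarAlgebra A] (W : X → A) (g : Fin n → X) (N : ℕ) :
    FiniteDimensional ℂ (weylBoxSubspace W g N) := by
  rw [weylBoxSubspace_eq]
  exact finiteDimensional_span_image W _

end Box

/-! ### Dimension estimates and algebraic amenability. -/

namespace IsWeylAlgebra

variable {X : Type u} [AddCommGroup X] [Module ℝ X] {σ : LinearMap.BilinForm ℝ X}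
  {A : Type v} [CStarAlgebra A] {W : X → A}

lemma finrank_span_image (hW : IsWeylAlgebra σ W) (hσ : σ.IsAlt) (hnd : σ.Nondegenerate)
    (B : Finset X) : Module.finrank ℂ (Submodule.span ℂ (W '' B)) = B.card := by
  have h := finrank_span_eq_card ((hW.linearIndependent hσ hnd).comp _
    (Subtype.val_injective (p := fun x => x ∈ B)))
  rw [Set.range_comp, Subtype.range_coe_subtype, Fintype.card_coe] at h
  exact h

open scoped Classical in
-- A product `W f * W y` with `y ∈ B` leaves the span over `B` only when `y` is a boundary point for
-- `f`.
lemma mulAddSubspace_le (hW : IsWeylAlgebra σ W) (s B : Finset X) {a : A}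
    (ha : a ∈ Submodule.span ℂ (W '' s)) :
    mulAddSubspace a (Submodule.span ℂ (W '' B)) ≤
      Submodule.span ℂ (W '' ↑(B ∪ s.biUnion fun f => (translationBoundary f B).image (f + ·))) := by
  refine sup_le ?_ (Submodule.span_mono (Set.image_mono (by simp)))
  rw [Submodule.map_le_iff_le_comap]
  intro b hb
  have hab := Submodule.mul_mem_mul ha hb
  rw [Submodule.span_mul_span] at hab
  rw [Submodule.mem_comap, LinearMap.mulLeft_apply]
  refine Submodule.span_le.2 ?_ hab
  rintro _ ⟨_, ⟨f, hf, rfl⟩, _, ⟨y, hy, rfl⟩, rfl⟩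
  simp only [hW.mul_eq]
  refine Submodule.smul_mem _ _ (Submodule.subset_span ⟨_, ?_, rfl⟩)
  rw [Finset.mem_coe, Finset.mem_union]
  by_cases h : f + y ∈ B
  · exact Or.inl h
  · exact Or.inr (Finset.mem_biUnion.2 ⟨f, hf,
      Finset.mem_image.2 ⟨y, mem_translationBoundary.2 ⟨hy, h⟩, rfl⟩⟩)

lemma finrank_mulAddSubspace_le (hW : IsWeylAlgebra σ W) (hσ : σ.IsAlt) (hnd : σ.Nondegenerate)
    (s B : Finset X) {a : A} (ha : a ∈ Submodule.span ℂ (W '' s)) :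
    Module.finrank ℂ (mulAddSubspace a (Submodule.span ℂ (W '' B))) ≤
      B.card + ∑ f ∈ s, (translationBoundary f B).card := by
  classical
  have := finiteDimensional_span_image W
    (B ∪ s.biUnion fun f => (translationBoundary f B).image (f + ·))
  refine (Submodule.finrank_mono (hW.mulAddSubspace_le s B ha)).trans ?_
  rw [hW.finrank_span_image hσ hnd]
  refine (Finset.card_union_le _ _).trans (Nat.add_le_add_left (Finset.card_biUnion_le.trans ?_) _)
  exact Finset.sum_le_sum fun f _ => Finset.card_image_le

lemma exists_support (hW : IsWeylAlgebra σ W) (F : Finset A) (hF : ∀ a ∈ F, a ∈ weylStarAlgebra W) :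
    ∃ s : Finset X, ∀ a ∈ F, a ∈ Submodule.span ℂ (W '' s) := by
  classical
  have h : ∀ a : A, ∃ s : Finset X, a ∈ F → a ∈ Submodule.span ℂ (W '' s) := by
    intro a
    by_cases ha : a ∈ F
    · obtain ⟨c, hc⟩ := Finsupp.mem_span_range_iff_exists_finsupp.1
        (hW.mem_weylStarAlgebra_iff.1 (hF a ha))
      refine ⟨c.support, fun _ => ?_⟩
      rw [← hc]
      exact Submodule.sum_mem _ fun f hf =>
        Submodule.smul_mem _ _ (Submodule.subset_span ⟨f, hf, rfl⟩)
    · exact ⟨∅, fun h => absurd h ha⟩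
  choose s hs using h
  refine ⟨F.biUnion s, fun a ha => Submodule.span_mono (Set.image_mono ?_) (hs a ha)⟩
  exact_mod_cast Finset.subset_biUnion_of_mem s ha

lemma weylBoxSubspace_le (hW : IsWeylAlgebra σ W) {n : ℕ} (g : Fin n → X) (N : ℕ) :
    weylBoxSubspace W g N ≤ (weylStarAlgebra W).toSubalgebra.toSubmodule := by
  rw [hW.weylStarAlgebra_toSubmodule, weylBoxSubspace_eq]
  exact Submodule.span_mono (Set.image_subset_range _ _)

lemma finrank_weylBoxSubspace (hW : IsWeylAlgebra σ W) (hσ : σ.IsAlt) (hnd : σ.Nondegenerate)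
    {n : ℕ} (g : Fin n → X) (N : ℕ) :
    Module.finrank ℂ (weylBoxSubspace W g N) = (boxFinset g N).card := by
  rw [weylBoxSubspace_eq, hW.finrank_span_image hσ hnd]

lemma finrank_weylBoxSubspace_pos (hW : IsWeylAlgebra σ W) (hσ : σ.IsAlt) (hnd : σ.Nondegenerate)
    {n : ℕ} (g : Fin n → X) {N : ℕ} (hN : 1 ≤ N) :
    0 < Module.finrank ℂ (weylBoxSubspace W g N) := by
  rw [hW.finrank_weylBoxSubspace hσ hnd]
  exact (boxFinset_nonempty g hN).card_pos

lemma weylBoxSubspace_ne_bot (hW : IsWeylAlgebra σ W) (hσ : σ.IsAlt) (hnd : σ.Nondegenerate)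
    {n : ℕ} (g : Fin n → X) {N : ℕ} (hN : 1 ≤ N) : weylBoxSubspace W g N ≠ ⊥ := by
  intro h
  have := hW.finrank_weylBoxSubspace_pos hσ hnd g hN
  rw [h, finrank_bot] at this
  exact lt_irrefl _ this

lemma finrank_mulAddSubspace_generator_le (hW : IsWeylAlgebra σ W) (hσ : σ.IsAlt)
    (hnd : σ.Nondegenerate) {n : ℕ} (g : Fin n → X) {N : ℕ} (hN : 1 ≤ N) (i : Fin n) :
    (Module.finrank ℂ (mulAddSubspace (W (g i)) (weylBoxSubspace W g N)) : ℝ) ≤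
      (1 + 1 / (N : ℝ)) * Module.finrank ℂ (weylBoxSubspace W g N) := by
  rw [hW.finrank_weylBoxSubspace hσ hnd, weylBoxSubspace_eq]
  have h := hW.finrank_mulAddSubspace_le hσ hnd {g i} (boxFinset g N)
    (Submodule.subset_span ⟨g i, by simp, rfl⟩)
  rw [Finset.sum_singleton] at h
  have h' : (Module.finrank ℂ (mulAddSubspace (W (g i))
      (Submodule.span ℂ (W '' boxFinset g N))) : ℝ) ≤
      (boxFinset g N).card + (translationBoundary (g i) (boxFinset g N)).card := by
    exact_mod_cast h
  have hN' : (N : ℝ) ≠ 0 := by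
    have : N ≠ 0 := by omega
    exact_mod_cast this
  have h2 := card_translationBoundary_le_of_mul_le (t := {g i}) (ε := 1 / N) hN
    (by rw [one_div_mul_cancel hN']) (g := g) (by simp) (Finset.mem_singleton_self _)
  linarith

lemma exists_box (hW : IsWeylAlgebra σ W) (hσ : σ.IsAlt) (hnd : σ.Nondegenerate)
    (F : Finset A) (hF : ∀ a ∈ F, a ∈ weylStarAlgebra W) {ε : ℝ} (hε : 0 < ε) :
    ∃ (n : ℕ) (g : Fin n → X) (N₀ : ℕ), ∀ N ≥ N₀, 1 ≤ N → ∀ a ∈ F,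
      (Module.finrank ℂ (mulAddSubspace a (weylBoxSubspace W g N)) : ℝ) ≤
        (1 + ε) * Module.finrank ℂ (weylBoxSubspace W g N) := by
  obtain ⟨s, hs⟩ := hW.exists_support F hF
  -- Each label in `s` may then cost the fraction `ε / (s.card + 1)`, for a total below `ε`; the `+
  -- 1` covers empty `s`.
  obtain ⟨N₀, hN₀⟩ := exists_nat_ge ((s.card + 1) / ε)
  refine ⟨s.card, fun i => (s.equivFin.symm i : X), N₀, fun N hN hN1 a ha => ?_⟩
  set g : Fin s.card → X := fun i => (s.equivFin.symm i : X) with hg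
  have hc : (0 : ℝ) < s.card + 1 := by positivity
  have hNε : 1 ≤ ε / (s.card + 1) * N := by
    have : (N₀ : ℝ) ≤ N := by exact_mod_cast hN
    have := hN₀.trans this
    rw [div_le_iff₀ hε] at this
    rw [div_mul_eq_mul_div, le_div_iff₀ hc]
    linarith
  rw [hW.finrank_weylBoxSubspace hσ hnd, weylBoxSubspace_eq]
  have h : (Module.finrank ℂ (mulAddSubspace a (Submodule.span ℂ (W '' boxFinset g N))) : ℝ) ≤
      (boxFinset g N).card + ∑ f ∈ s, ((translationBoundary f (boxFinset g N)).card : ℝ) := by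
    exact_mod_cast hW.finrank_mulAddSubspace_le hσ hnd s (boxFinset g N) (hs a ha)
  have h2 : ∑ f ∈ s, ((translationBoundary f (boxFinset g N)).card : ℝ) ≤
      s.card • (ε / (s.card + 1) * (boxFinset g N).card) :=
    Finset.sum_le_card_nsmul _ _ _ fun f hf => card_translationBoundary_le_of_mul_le hN1 hNε
      (fun f hf => ⟨s.equivFin ⟨f, hf⟩, by simp [hg]⟩) hf
  have h3 : s.card • (ε / (s.card + 1) * ((boxFinset g N).card : ℝ)) ≤
      ε * (boxFinset g N).card := by
    rw [nsmul_eq_mul, ← mul_assoc]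
    refine mul_le_mul_of_nonneg_right ?_ (Nat.cast_nonneg _)
    rw [mul_div_assoc', div_le_iff₀ hc]
    nlinarith
  linarith

lemma isAlgebraicallyAmenable (hW : IsWeylAlgebra σ W) (hσ : σ.IsAlt) (hnd : σ.Nondegenerate) :
    IsAlgebraicallyAmenable (weylStarAlgebra W) := by
  classical
  have key : ∀ p : Finset (weylStarAlgebra W) × ℕ, ∃ V : Submodule ℂ A,
      (V ≤ (weylStarAlgebra W).toSubalgebra.toSubmodule ∧ V ≠ ⊥ ∧ FiniteDimensional ℂ V) ∧
      0 < Module.finrank ℂ V ∧ ∀ a ∈ p.1, (Module.finrank ℂ (mulAddSubspace (a : A) V) : ℝ) ≤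
        (1 + 1 / ((p.2 : ℝ) + 1)) * Module.finrank ℂ V := by
    rintro ⟨F, m⟩
    obtain ⟨n, g, N₀, h⟩ := hW.exists_box hσ hnd (F.image Subtype.val)
      (fun a ha => by obtain ⟨b, -, rfl⟩ := Finset.mem_image.1 ha; exact b.2)
      (ε := 1 / ((m : ℝ) + 1)) Nat.one_div_pos_of_nat
    refine ⟨weylBoxSubspace W g (max N₀ 1), ⟨hW.weylBoxSubspace_le _ _,
      hW.weylBoxSubspace_ne_bot hσ hnd _ (le_max_right _ _),
      finiteDimensional_weylBoxSubspace W _ _⟩,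
      hW.finrank_weylBoxSubspace_pos hσ hnd _ (le_max_right _ _), fun a ha => ?_⟩
    exact h _ (le_max_left _ _) (le_max_right _ _) _ (Finset.mem_image_of_mem _ ha)
  choose V hV hpos hle using key
  refine ⟨Finset (weylStarAlgebra W) × ℕ, inferInstance, inferInstance, inferInstance, V, hV,
    fun a ha => ?_⟩
  have hlim : Tendsto (fun p : Finset (weylStarAlgebra W) × ℕ => 1 + 1 / ((p.2 : ℝ) + 1))
      atTop (𝓝 1) := by
    have h := (tendsto_one_div_add_atTop_nhds_zero_nat (𝕜 := ℝ)).const_add 1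
    rw [add_zero] at h
    rw [← prod_atTop_atTop_eq]
    exact h.comp tendsto_snd
  refine tendsto_of_tendsto_of_tendsto_of_le_of_le' tendsto_const_nhds hlim
    (Eventually.of_forall fun p => ?_) ?_
  · have := (hV p).2.2
    have hfd : FiniteDimensional ℂ (mulAddSubspace a (V p)) := by
      unfold mulAddSubspace; infer_instance
    rw [le_div_iff₀ (by exact_mod_cast hpos p), one_mul]
    exact_mod_cast Submodule.finrank_mono (le_sup_right : V p ≤ mulAddSubspace a (V p))
  -- Past this index the finite set contains `a`, so the bound chosen for the index applies.
  · filter_upwards [eventually_ge_atTop (({⟨a, ha⟩} : Finset (weylStarAlgebra W)), 0)] with p hp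
    rw [div_le_iff₀ (by exact_mod_cast hpos p)]
    exact hle p ⟨a, ha⟩ (hp.1 (Finset.mem_singleton_self _))

end IsWeylAlgebra

/-! ### Complete positivity and contractivity of compressions. -/

open scoped MatrixOrder Matrix Matrix.Norms.L2Operator in
lemma Matrix.PosSemidef.exists_conjTranspose_mul_self {n : Type*} [Fintype n] [DecidableEq n]
    {M : Matrix n n ℂ} (hM : M.PosSemidef) : ∃ C : Matrix n n ℂ, M = Cᴴ * C :=
  CStarAlgebra.nonneg_iff_eq_star_mul_self.1 hM.nonneg

lemma exists_eq_star_mul_self_of_nonneg {B : Type*} [NonUnitalCStarAlgebra B] [PartialOrder B]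
    [StarOrderedRing B] {b : B} (hb : 0 ≤ b) : ∃ c, b = star c * c :=
  CStarAlgebra.nonneg_iff_eq_star_mul_self.1 hb

/-- A matrix of matrices is nonnegative if it is positive semidefinite as a scalar matrix. -/
lemma CStarMatrix.nonneg_of_posSemidef {n k : ℕ}
    (P : CStarMatrix (Fin n) (Fin n) (CStarMatrix (Fin k) (Fin k) ℂ))
    (hP : (Matrix.of fun p q : Fin n × Fin k => P p.1 q.1 p.2 q.2).PosSemidef) : 0 ≤ P := by
  obtain ⟨C, hC⟩ := hP.exists_conjTranspose_mul_self
  -- Regroup a square factor of the flattened matrix into blocks.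
  let D : CStarMatrix (Fin n) (Fin n) (CStarMatrix (Fin k) (Fin k) ℂ) :=
    CStarMatrix.ofMatrix fun i j => CStarMatrix.ofMatrix fun x y => C (i, x) (j, y)
  suffices P = star D * D by rw [this]; exact star_mul_self_nonneg D
  ext i j x y
  have h := congrFun (congrFun hC (i, x)) (j, y)
  rw [Matrix.of_apply, Matrix.mul_apply, Fintype.sum_prod_type] at h
  rw [h, CStarMatrix.mul_apply]
  have hsum : ∀ (s : Finset (Fin n)) (f : Fin n → CStarMatrix (Fin k) (Fin k) ℂ),
      (∑ l ∈ s, f l) x y = ∑ l ∈ s, f l x y := fun s f => Matrix.sum_apply x y s f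
  rw [hsum]
  rfl

section Compression

variable {A : Type v} [CStarAlgebra A] [PartialOrder A] [StarOrderedRing A]

/-- The completely positive map `a ↦ (τ(wᵢ⋆ a wⱼ))ᵢⱼ`. -/
def compressionMap (τ : A →ₚ[ℂ] ℂ) {k : ℕ} (w : Fin k → A) :
    A →CP CStarMatrix (Fin k) (Fin k) ℂ where
  toFun a := CStarMatrix.ofMatrix fun i j => τ (star (w i) * a * w j)
  map_add' a b := by
    refine CStarMatrix.ext fun i j => ?_
    change τ _ = τ _ + τ _
    simp [mul_add, add_mul]
  map_smul' c a := by
    refine CStarMatrix.ext fun i j => ?_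
    change τ _ = c • τ _
    simp
  map_cstarMatrix_nonneg' n M hM := by
    refine CStarMatrix.nonneg_of_posSemidef _ ?_
    obtain ⟨b, rfl⟩ := exists_eq_star_mul_self_of_nonneg hM
    -- With `M = star b * b`, the flattened image is a sum over the rows `l` of `b` of Gram matrices
    -- in the pre-GNS space.
    have h := Matrix.posSemidef_sum (Finset.univ : Finset (Fin n)) fun l _ =>
      Matrix.posSemidef_gram ℂ fun p : Fin n × Fin k => τ.toPreGNS (b l p.1 * w p.2)
    refine Eq.subst (motive := fun M : Matrix (Fin n × Fin k) (Fin n × Fin k) ℂ => M.PosSemidef)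
      (Eq.symm ?_) h
    refine Matrix.ext fun p q => ?_
    rw [Matrix.sum_apply]
    change τ (star (w p.2) * (∑ l, star (b l p.1) * b l q.1) * w q.2) = _
    rw [Finset.mul_sum, Finset.sum_mul, map_sum]
    refine Finset.sum_congr rfl fun l _ => ?_
    rw [Matrix.gram_apply, PositiveLinearMap.preGNS_inner_def]
    simp [mul_assoc]

lemma compressionMap_apply (τ : A →ₚ[ℂ] ℂ) {k : ℕ} (w : Fin k → A) (a : A) (i j : Fin k) :
    compressionMap τ w a i j = τ (star (w i) * a * w j) := rfl

lemma norm_sum_preGNS {τ : A →ₚ[ℂ] ℂ} {k : ℕ} {w : Fin k → A}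
    (hw : Orthonormal ℂ fun i => τ.toPreGNS (w i)) (v : WithCStarModule ℂ (Fin k → ℂ)) :
    ‖∑ i, star (v i) • τ.toPreGNS (w i)‖ = ‖v‖ := by
  rw [← sq_eq_sq₀ (norm_nonneg _) (norm_nonneg _), WithCStarModule.pi_norm_sq]
  have h := hw.inner_sum (fun i => star (v i)) (fun i => star (v i)) Finset.univ
  rw [inner_self_eq_norm_sq_to_K] at h
  have h' := congrArg norm h
  simpa [WithCStarModule.inner_def, Complex.mul_conj'] using h'

/-- Compressions to orthonormal families are contractive. -/
lemma norm_compressionMap_le {τ : A →ₚ[ℂ] ℂ} {k : ℕ} {w : Fin k → A}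
    (hw : Orthonormal ℂ fun i => τ.toPreGNS (w i)) (a : A) : ‖compressionMap τ w a‖ ≤ ‖a‖ := by
  refine CStarMatrix.norm_le_of_forall_inner_le (C := ‖a‖₊) fun v u => ?_
  -- The matrix acts on row vectors, hence the conjugated coefficients and the exchanged roles of
  -- `u` and `v`.
  have key : inner ℂ u (CStarMatrix.toCLM (compressionMap τ w a) v) =
      inner ℂ (∑ i, star (v i) • τ.toPreGNS (w i))
        (τ.leftMulMapPreGNS a (∑ j, star (u j) • τ.toPreGNS (w j))) := by
    rw [map_sum, sum_inner]
    simp_rw [inner_sum]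
    rw [WithCStarModule.pi_inner, Finset.sum_comm]
    refine Finset.sum_congr rfl fun j _ => ?_
    rw [WithCStarModule.inner_def, CStarMatrix.toCLM_apply_eq_sum,
      WithCStarModule.equiv_symm_pi_apply, Finset.sum_mul]
    refine Finset.sum_congr rfl fun i _ => ?_
    rw [compressionMap_apply, map_smul, inner_smul_left, inner_smul_right,
      PositiveLinearMap.preGNS_inner_def]
    simp [mul_assoc, mul_comm (starRingEnd ℂ (u j))]
  rw [key]
  refine (norm_inner_le_norm _ _).trans ?_
  rw [norm_sum_preGNS hw]
  refine (mul_le_mul_of_nonneg_left (ContinuousLinearMap.le_of_opNorm_le (c := ‖a‖) _ ?_ _)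
    (norm_nonneg _)).trans (le_of_eq ?_)
  · exact LinearMap.mkContinuous_norm_le _ (norm_nonneg a) _
  · rw [norm_sum_preGNS hw, coe_nnnorm]
    ring

end Compression

/-! ### The contraction from matrices back to the algebra. -/

section Reconstruction

variable {A : Type v} [CStarAlgebra A]

/-- The map `T ↦ k⁻¹ ∑ᵢⱼ Tᵢⱼ wᵢ wⱼ⋆`, which approximately inverts compressions. -/
def reconstructionMap {k : ℕ} (w : Fin k → A) : CStarMatrix (Fin k) (Fin k) ℂ →ₗ[ℂ] A where
  toFun T := (k : ℂ)⁻¹ • ∑ i, ∑ j, T i j • (w i * star (w j))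
  map_add' S T := by
    simp [add_smul, Finset.sum_add_distrib]
  map_smul' c T := by
    simp only [CStarMatrix.smul_apply, smul_assoc, ← Finset.smul_sum, RingHom.id_apply]
    rw [smul_comm]

lemma reconstructionMap_apply {k : ℕ} (w : Fin k → A) (T : CStarMatrix (Fin k) (Fin k) ℂ) :
    reconstructionMap w T = (k : ℂ)⁻¹ • ∑ i, ∑ j, T i j • (w i * star (w j)) := rfl

/-- The double sum is the corner entry of `R * T' * star R`, where `R` is the row of the `w j`
padded by zeros to a square matrix. Unitarity gives `R * star R = k • Q` with `Q` a projection, so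
`‖R‖ ^ 2 ≤ k`, which the factor `k⁻¹` cancels. -/
lemma norm_reconstructionMap_le [PartialOrder A] [StarOrderedRing A] {k : ℕ} (hk : 0 < k) {w : Fin k → A}
    (hw : ∀ i, w i * star (w i) = 1) (T : CStarMatrix (Fin k) (Fin k) ℂ) :
    ‖reconstructionMap w T‖ ≤ ‖T‖ := by
  let i₀ : Fin k := ⟨0, hk⟩
  let R : CStarMatrix (Fin k) (Fin k) A := CStarMatrix.ofMatrix fun i j => if i = i₀ then w j else 0
  let Q : CStarMatrix (Fin k) (Fin k) A :=
    CStarMatrix.ofMatrix fun i j => if i = i₀ ∧ j = i₀ then 1 else 0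
  let T' : CStarMatrix (Fin k) (Fin k) A :=
    CStarMatrix.mapₙₐ ((StarAlgHom.ofId ℂ A : ℂ →⋆ₐ[ℂ] A) : ℂ →⋆ₙₐ[ℂ] A) T
  have hRapp : ∀ i j, R i j = if i = i₀ then w j else 0 := fun _ _ => rfl
  have hQapp : ∀ i j, Q i j = if i = i₀ ∧ j = i₀ then 1 else 0 := fun _ _ => rfl
  have hQ : star Q * Q = Q := by
    ext i j
    rw [CStarMatrix.mul_apply, Finset.sum_eq_single i₀]
    · by_cases hi : i = i₀ <;> by_cases hj : j = i₀ <;> simp [hQapp, hi, hj, CStarMatrix.star_apply]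
    · intro l _ hl
      simp [hQapp, hl, CStarMatrix.star_apply]
    · simp
  have hQ1 : ‖Q‖ ≤ 1 := by
    have h := CStarRing.norm_star_mul_self (x := Q)
    rw [hQ] at h
    nlinarith [norm_nonneg Q]
  have hRR : R * star R = (k : ℂ) • Q := by
    ext i j
    rw [CStarMatrix.mul_apply]
    by_cases hi : i = i₀ <;> by_cases hj : j = i₀ <;>
      simp [hRapp, hQapp, hi, hj, CStarMatrix.star_apply, hw, Algebra.smul_def]
  have hR : ‖R‖ * ‖R‖ ≤ k := by
    rw [← CStarRing.norm_self_mul_star, hRR, norm_smul]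
    simpa using mul_le_mul_of_nonneg_left hQ1 (Nat.cast_nonneg k)
  have hT' : ‖T'‖ ≤ ‖T‖ := NonUnitalStarAlgHom.norm_apply_le _ _
  have hentry : (R * T' * star R) i₀ i₀ = ∑ i, ∑ j, T i j • (w i * star (w j)) := by
    rw [CStarMatrix.mul_apply, Finset.sum_comm]
    refine Finset.sum_congr rfl fun j _ => ?_
    rw [CStarMatrix.mul_apply, Finset.sum_mul]
    refine Finset.sum_congr rfl fun i _ => ?_
    have h1 : R i₀ i = w i := by simp [hRapp]
    have h2 : T' i j = algebraMap ℂ A (T i j) := rfl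
    have h3 : (star R) j i₀ = star (w j) := by simp [hRapp, CStarMatrix.star_apply]
    rw [h1, h2, h3, Algebra.algebraMap_eq_smul_one, mul_smul_comm, mul_one, smul_mul_assoc]
  rw [reconstructionMap_apply, ← hentry, norm_smul, norm_inv, Complex.norm_natCast]
  have hk' : (0 : ℝ) < k := by exact_mod_cast hk
  rw [inv_mul_le_iff₀ hk']
  calc ‖(R * T' * star R) i₀ i₀‖ ≤ ‖R * T' * star R‖ := CStarMatrix.norm_entry_le_norm
    _ ≤ ‖R‖ * ‖T'‖ * ‖star R‖ :=
        (norm_mul_le _ _).trans (mul_le_mul_of_nonneg_right (norm_mul_le _ _) (norm_nonneg _))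
    _ = ‖R‖ * ‖R‖ * ‖T'‖ := by rw [norm_star]; ring
    _ ≤ k * ‖T‖ := mul_le_mul hR hT' (norm_nonneg _) hk'.le

end Reconstruction

/-! ### The normalized trace norm and a density argument. -/

section TraceNorm

variable {k : ℕ}

lemma re_star_mul_self_apply (F : CStarMatrix (Fin k) (Fin k) ℂ) (j : Fin k) :
    ((star F * F) j j).re = ∑ i, ‖F i j‖ ^ 2 := by
  rw [CStarMatrix.mul_apply, Complex.re_sum]
  refine Finset.sum_congr rfl fun i _ => ?_
  rw [CStarMatrix.star_apply, Complex.star_def, ← Complex.normSq_eq_conj_mul_self,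
    Complex.ofReal_re, Complex.normSq_eq_norm_sq]

lemma sum_norm_sq_column_le (F : CStarMatrix (Fin k) (Fin k) ℂ) (j : Fin k) :
    ∑ i, ‖F i j‖ ^ 2 ≤ ‖F‖ ^ 2 := by
  rw [← re_star_mul_self_apply, sq, ← CStarRing.norm_star_mul_self]
  exact (Complex.re_le_norm _).trans CStarMatrix.norm_entry_le_norm

lemma traceNorm₂_eq (F : CStarMatrix (Fin k) (Fin k) ℂ) :
    traceNorm₂ F = √((∑ j, ∑ i, ‖F i j‖ ^ 2) / k) := by
  rw [traceNorm₂, Complex.re_sum]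
  simp_rw [re_star_mul_self_apply]

/-- A matrix supported on the columns in `J`, where it agrees with `F`. -/
lemma traceNorm₂_le_of_columns (D F : CStarMatrix (Fin k) (Fin k) ℂ) (J : Finset (Fin k))
    (h0 : ∀ j ∉ J, ∀ i, D i j = 0) (h1 : ∀ j ∈ J, ∀ i, D i j = F i j) :
    traceNorm₂ D ≤ √((J.card : ℝ) / k) * ‖F‖ := by
  rw [traceNorm₂_eq, ← Real.sqrt_sq (norm_nonneg F), ← Real.sqrt_mul (by positivity)]
  refine Real.sqrt_le_sqrt ?_
  rw [div_mul_eq_mul_div]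
  refine div_le_div_of_nonneg_right ?_ (Nat.cast_nonneg k)
  rw [← nsmul_eq_mul, ← Finset.sum_subset (Finset.subset_univ J)]
  · refine Finset.sum_le_card_nsmul _ _ _ fun j hj => ?_
    simp_rw [h1 j hj]
    exact sum_norm_sq_column_le F j
  · intro j _ hj
    simp [h0 j hj]

lemma traceNorm₂_le_norm (F : CStarMatrix (Fin k) (Fin k) ℂ) : traceNorm₂ F ≤ ‖F‖ := by
  refine (traceNorm₂_le_of_columns F F Finset.univ (by simp) (by simp)).trans ?_
  refine mul_le_of_le_one_left (norm_nonneg F) ?_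
  rw [Finset.card_univ, Fintype.card_fin, Real.sqrt_le_one]
  exact div_self_le_one _

/-- The columns of a matrix as a vector in a Euclidean space. -/
def columnVector (k : ℕ) :
    CStarMatrix (Fin k) (Fin k) ℂ →ₗ[ℂ] EuclideanSpace ℂ (Fin k × Fin k) where
  toFun F := WithLp.toLp 2 fun p => F p.2 p.1
  map_add' _ _ := rfl
  map_smul' _ _ := rfl

/-- `traceNorm₂` as a seminorm. -/
def traceSeminorm (k : ℕ) : Seminorm ℂ (CStarMatrix (Fin k) (Fin k) ℂ) :=
  (NNReal.sqrt k)⁻¹ • (normSeminorm ℂ (EuclideanSpace ℂ (Fin k × Fin k))).comp (columnVector k)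

lemma traceSeminorm_apply (F : CStarMatrix (Fin k) (Fin k) ℂ) :
    traceSeminorm k F = traceNorm₂ F := by
  have h : traceSeminorm k F = (√(k : ℝ))⁻¹ * ‖columnVector k F‖ := by
    simp [traceSeminorm, NNReal.smul_def]
  rw [h, traceNorm₂_eq, EuclideanSpace.norm_eq, Fintype.sum_prod_type, Real.sqrt_div (by positivity),
    div_eq_inv_mul]
  rfl

end TraceNorm

/-- Uniformly bounded seminorms converging to `0` on a total set converge to `0` everywhere. -/
lemma tendsto_seminorm_zero_of_dense_span {E ι : Type*} [NormedAddCommGroup E] [NormedSpace ℂ E]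
    {l : Filter ι} (p : ι → Seminorm ℂ E) {C : ℝ} (hC : ∀ i a, p i a ≤ C * ‖a‖) {S : Set E}
    (hS : Dense (Submodule.span ℂ S : Set E)) (h : ∀ a ∈ S, Tendsto (fun i => p i a) l (𝓝 0))
    (a : E) : Tendsto (fun i => p i a) l (𝓝 0) := by
  have hspan : ∀ b ∈ Submodule.span ℂ S, Tendsto (fun i => p i b) l (𝓝 0) := by
    intro b hb
    induction hb using Submodule.span_induction with
    | mem x hx => exact h x hx
    | zero => simpa using tendsto_const_nhds
    | add x y _ _ hx hy =>
      refine squeeze_zero (fun i => apply_nonneg _ _) (fun i => map_add_le_add (p i) x y) ?_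
      simpa using hx.add hy
    | smul c x _ hx =>
      simp_rw [map_smul_eq_mul]
      simpa using hx.const_mul ‖c‖
  rw [Metric.tendsto_nhds]
  intro ε hε
  -- `|C| + 1` is a positive bound for `C`, whatever its sign.
  obtain ⟨b, hb, hab⟩ := Metric.dense_iff.1 hS a (ε / 2 / (|C| + 1)) (by positivity)
  filter_upwards [Metric.tendsto_nhds.1 (hspan _ hab) (ε / 2) (by positivity)] with i hi
  rw [Real.dist_0_eq_abs, abs_of_nonneg (apply_nonneg _ _)] at hi ⊢
  have h1 : p i a ≤ p i (a - b) + p i b := by simpa using map_add_le_add (p i) (a - b) b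
  have h2 : p i (a - b) ≤ ε / 2 := by
    rw [Metric.mem_ball, dist_comm, dist_eq_norm, lt_div_iff₀ (by positivity)] at hb
    have := hC i (a - b)
    have := le_abs_self C
    nlinarith [norm_nonneg (a - b)]
  linarith

/-! ### Weyl families over finite sets. -/

/-- An enumeration of a finite set. -/
def enumFinset {X : Type u} (B : Finset X) (i : Fin B.card) : X := B.equivFin.symm i

section Enum

variable {X : Type u}

lemma enumFinset_mem (B : Finset X) (i : Fin B.card) : enumFinset B i ∈ B :=
  (B.equivFin.symm i).2

lemma enumFinset_injective (B : Finset X) : Function.Injective (enumFinset B) :=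
  Subtype.val_injective.comp B.equivFin.symm.injective

lemma exists_enumFinset_eq {B : Finset X} {y : X} (hy : y ∈ B) : ∃ i, enumFinset B i = y :=
  ⟨B.equivFin ⟨y, hy⟩, by simp [enumFinset]⟩

open scoped Classical in
/-- The indices of the points which the translation by `f` moves out of `B`. -/
def boundaryIndices [AddCommGroup X] (f : X) (B : Finset X) : Finset (Fin B.card) :=
  Finset.univ.filter fun j => f + enumFinset B j ∉ B

lemma mem_boundaryIndices [AddCommGroup X] {f : X} {B : Finset X} {j : Fin B.card} :
    j ∈ boundaryIndices f B ↔ f + enumFinset B j ∉ B := by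
  simp [boundaryIndices]

lemma card_boundaryIndices_le [AddCommGroup X] (f : X) (B : Finset X) :
    (boundaryIndices f B).card ≤ (translationBoundary f B).card :=
  Finset.card_le_card_of_injOn (enumFinset B)
    (fun j hj => mem_translationBoundary.2 ⟨enumFinset_mem B j, mem_boundaryIndices.1 hj⟩)
    (enumFinset_injective B).injOn

/-- The Weyl elements indexed by an enumeration of `B`. -/
def weylFamily {A : Type v} (W : X → A) (B : Finset X) (i : Fin B.card) : A := W (enumFinset B i)

lemma orthonormal_weylFamily {A : Type v} [CStarAlgebra A] [PartialOrder A] [StarOrderedRing A]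
    {W : X → A} {τ : A →ₚ[ℂ] ℂ} (h1 : ∀ f, τ (star (W f) * W f) = 1)
    (h0 : ∀ f g, f ≠ g → τ (star (W f) * W g) = 0) (B : Finset X) :
    Orthonormal ℂ fun i => τ.toPreGNS (weylFamily W B i) := by
  refine ⟨fun i => ?_, fun i j hij => ?_⟩
  · rw [PositiveLinearMap.preGNS_norm_def, PositiveLinearMap.ofPreGNS_toPreGNS]
    simp [weylFamily, h1]
  · exact h0 _ _ fun h => hij (enumFinset_injective B h)

end Enum

/-! ### The Følner property of the Weyl algebra. -/

namespace IsWeylAlgebra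

variable {X : Type u} [AddCommGroup X] [Module ℝ X] {σ : LinearMap.BilinForm ℝ X}
  {A : Type v} [CStarAlgebra A] {W : X → A}

lemma norm_weyl (hW : IsWeylAlgebra σ W) (f : X) : ‖W f‖ = 1 := by
  have := hW.nontrivial
  exact CStarRing.norm_of_mem_unitary (hW.unitary f)

section State

variable [PartialOrder A] [StarOrderedRing A] {τ : A →ₚ[ℂ] ℂ}

/-- Away from the boundary `W f` sends a basis vector to a multiple of another one, so the
compression loses nothing in that column. -/
lemma compressionMap_weyl_of_mem (hW : IsWeylAlgebra σ W) (h1 : ∀ f, τ (star (W f) * W f) = 1)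
    (h0 : ∀ f g, f ≠ g → τ (star (W f) * W g) = 0) {B : Finset X} {f : X} {j : Fin B.card}
    (hj : f + enumFinset B j ∈ B) :
    ∃ (l : Fin B.card) (c : ℂ), W f * weylFamily W B j = c • weylFamily W B l ∧
      compressionMap τ (weylFamily W B) (W f) l j = c ∧
      ∀ i, i ≠ l → compressionMap τ (weylFamily W B) (W f) i j = 0 := by
  obtain ⟨l, hl⟩ := exists_enumFinset_eq hj
  have hmul := hW.mul_eq f (enumFinset B j)
  rw [← hl] at hmul
  refine ⟨l, _, hmul, ?_, fun i hi => ?_⟩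
  · rw [compressionMap_apply, mul_assoc, weylFamily, weylFamily, hmul, mul_smul_comm, map_smul, h1,
      smul_eq_mul, mul_one]
  · rw [compressionMap_apply, mul_assoc, weylFamily, weylFamily, hmul, mul_smul_comm, map_smul,
      h0 _ _ (fun h => hi (enumFinset_injective B h)), smul_zero]

lemma compressionMap_weyl_of_notMem (hW : IsWeylAlgebra σ W)
    (h0 : ∀ f g, f ≠ g → τ (star (W f) * W g) = 0) {B : Finset X} {f : X} {j : Fin B.card}
    (hj : f + enumFinset B j ∉ B) (i : Fin B.card) :
    compressionMap τ (weylFamily W B) (W f) i j = 0 := by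
  rw [compressionMap_apply, mul_assoc, weylFamily, weylFamily, hW.mul_eq, mul_smul_comm, map_smul,
    h0 (enumFinset B i) (f + enumFinset B j) (fun h => hj (h ▸ enumFinset_mem B i)), smul_zero]

/-- Off the boundary columns the two matrices agree. In a boundary column the product vanishes,
leaving a column of the compression of `a * W f`, whose norm is at most `‖a‖`. -/
lemma traceNorm₂_compressionMap_mul_weyl_le (hW : IsWeylAlgebra σ W)
    (h1 : ∀ f, τ (star (W f) * W f) = 1) (h0 : ∀ f g, f ≠ g → τ (star (W f) * W g) = 0)
    (B : Finset X) (a : A) (f : X) :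
    traceNorm₂ (compressionMap τ (weylFamily W B) (a * W f) -
      compressionMap τ (weylFamily W B) a * compressionMap τ (weylFamily W B) (W f)) ≤
      √((translationBoundary f B).card / B.card) * ‖a‖ := by
  refine (traceNorm₂_le_of_columns _ (compressionMap τ (weylFamily W B) (a * W f))
    (boundaryIndices f B) (fun j hj i => ?_) (fun j hj i => ?_)).trans ?_
  · rw [mem_boundaryIndices, not_not] at hj
    obtain ⟨l, c, hmul, hl, hne⟩ := hW.compressionMap_weyl_of_mem h1 h0 hj
    rw [CStarMatrix.sub_apply, CStarMatrix.mul_apply, Finset.sum_eq_single l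
      (fun m _ hm => by rw [hne m hm, mul_zero]) (fun h => absurd (Finset.mem_univ l) h), hl,
      compressionMap_apply, compressionMap_apply, ← mul_assoc, mul_assoc _ (W f), hmul,
      mul_smul_comm, map_smul, smul_eq_mul, mul_comm, sub_self]
  · rw [mem_boundaryIndices] at hj
    rw [CStarMatrix.sub_apply, CStarMatrix.mul_apply, Finset.sum_eq_zero, sub_zero]
    exact fun m _ => by rw [hW.compressionMap_weyl_of_notMem h0 hj, mul_zero]
  · refine mul_le_mul (Real.sqrt_le_sqrt (div_le_div_of_nonneg_right ?_ (Nat.cast_nonneg _))) ?_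
      (norm_nonneg _) (Real.sqrt_nonneg _)
    · exact_mod_cast card_boundaryIndices_le f B
    · refine (norm_compressionMap_le (orthonormal_weylFamily h1 h0 B) _).trans ?_
      simpa [hW.norm_weyl] using norm_mul_le a (W f)

/-- Each column off the boundary contributes `W f * w j * star (w j) = W f` and each boundary column
`0`, so the result is `W f` times the proportion of nonboundary points. -/
lemma norm_reconstruction_compression_weyl_sub_le (hW : IsWeylAlgebra σ W)
    (h1 : ∀ f, τ (star (W f) * W f) = 1) (h0 : ∀ f g, f ≠ g → τ (star (W f) * W g) = 0)
    {B : Finset X} (hB : B.Nonempty) (f : X) :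
    ‖reconstructionMap (weylFamily W B) (compressionMap τ (weylFamily W B) (W f)) - W f‖ ≤
      (translationBoundary f B).card / B.card := by
  classical
  have hk : (B.card : ℂ) ≠ 0 := by exact_mod_cast hB.card_pos.ne'
  have hcol : ∀ j, ∑ i, compressionMap τ (weylFamily W B) (W f) i j •
      (weylFamily W B i * star (weylFamily W B j)) =
      if j ∈ boundaryIndices f B then 0 else W f := by
    intro j
    split_ifs with hj
    · rw [mem_boundaryIndices] at hj
      exact Finset.sum_eq_zero fun i _ => by
        rw [hW.compressionMap_weyl_of_notMem h0 hj, zero_smul]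
    · rw [mem_boundaryIndices, not_not] at hj
      obtain ⟨l, c, hmul, hl, hne⟩ := hW.compressionMap_weyl_of_mem h1 h0 hj
      rw [Finset.sum_eq_single l (fun m _ hm => by rw [hne m hm, zero_smul])
        (fun h => absurd (Finset.mem_univ l) h), hl, ← smul_mul_assoc, ← hmul, mul_assoc]
      rw [weylFamily, hW.self_mul_star_eq, mul_one]
  have hdiff : reconstructionMap (weylFamily W B) (compressionMap τ (weylFamily W B) (W f)) - W f =
      -((B.card : ℂ)⁻¹ • ((boundaryIndices f B).card : ℂ) • W f) := by
    have hsum : ∑ j : Fin B.card, (if j ∈ boundaryIndices f B then 0 else W f) +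
        ((boundaryIndices f B).card : ℂ) • W f = (B.card : ℂ) • W f := by
      have h2 : ((boundaryIndices f B).card : ℂ) • W f =
          ∑ j : Fin B.card, if j ∈ boundaryIndices f B then W f else 0 := by
        rw [Finset.sum_ite_mem, Finset.univ_inter, Finset.sum_const, Nat.cast_smul_eq_nsmul]
      rw [h2, ← Finset.sum_add_distrib, Finset.sum_congr rfl (g := fun _ => W f)]
      · rw [Finset.sum_const, Finset.card_univ, Fintype.card_fin, Nat.cast_smul_eq_nsmul]
      · intro j _
        split_ifs <;> simp
    rw [reconstructionMap_apply, Finset.sum_comm, Finset.sum_congr rfl fun j _ => hcol j,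
      eq_sub_of_add_eq hsum, smul_sub, inv_smul_smul₀ hk]
    abel
  rw [hdiff, norm_neg, norm_smul, norm_smul, hW.norm_weyl, norm_inv, Complex.norm_natCast,
    Complex.norm_natCast, mul_one, ← div_eq_inv_mul]
  refine div_le_div_of_nonneg_right ?_ (Nat.cast_nonneg _)
  exact_mod_cast card_boundaryIndices_le f B

end State

/-- The defect of multiplicativity of a linear map, as a linear map of the second factor. -/
def multiplicativityDefect {k : ℕ} (φ : A →ₗ[ℂ] CStarMatrix (Fin k) (Fin k) ℂ) (a : A) :
    A →ₗ[ℂ] CStarMatrix (Fin k) (Fin k) ℂ :=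
  φ ∘ₗ LinearMap.mulLeft ℂ a - LinearMap.mulLeft ℂ (φ a) ∘ₗ φ

lemma isFolnerCStarAlgebra [PartialOrder A] [StarOrderedRing A] (hW : IsWeylAlgebra σ W)
    (hσ : σ.IsAlt) (hnd : σ.Nondegenerate) : IsFolnerCStarAlgebra A := by
  classical
  obtain ⟨τ, h1, h0⟩ := hW.exists_state hσ hnd
  have hinj : Function.Injective W := by
    have := hW.nontrivial
    exact (hW.linearIndependent hσ hnd).injective
  have key : ∀ p : Finset A × ℕ, ∃ B : Finset X, B.Nonempty ∧ ∀ f, W f ∈ p.1 →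
      ((translationBoundary f B).card : ℝ) ≤ 1 / ((p.2 : ℝ) + 1) * B.card := by
    rintro ⟨s, m⟩
    -- Injectivity of `W` makes the set of labels to control finite.
    obtain ⟨B, hB, h⟩ := exists_folner_finset (s.preimage W hinj.injOn)
      (ε := 1 / ((m : ℝ) + 1)) Nat.one_div_pos_of_nat
    exact ⟨B, hB, fun f hf => h f (Finset.mem_preimage.2 hf)⟩
  choose B hB hfol using key
  have hcard : ∀ p, (0 : ℝ) < (B p).card := fun p => by exact_mod_cast (hB p).card_pos
  let w := fun p => weylFamily W (B p)
  let φ := fun p => compressionMap τ (w p)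
  have hcontr : ∀ p a, ‖φ p a‖ ≤ ‖a‖ := fun p a =>
    norm_compressionMap_le (orthonormal_weylFamily h1 h0 (B p)) a
  have hrec : ∀ p T, ‖reconstructionMap (w p) T‖ ≤ ‖T‖ := fun p T =>
    norm_reconstructionMap_le (hB p).card_pos (fun i => hW.self_mul_star_eq _) T
  have hlim : Tendsto (fun p : Finset A × ℕ => 1 / ((p.2 : ℝ) + 1)) atTop (𝓝 0) := by
    rw [← prod_atTop_atTop_eq]
    exact (tendsto_one_div_add_atTop_nhds_zero_nat (𝕜 := ℝ)).comp tendsto_snd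
  have hratio : ∀ f, Tendsto
      (fun p => ((translationBoundary f (B p)).card : ℝ) / (B p).card) atTop (𝓝 0) := by
    intro f
    refine squeeze_zero' (Eventually.of_forall fun p => by positivity) ?_ hlim
    filter_upwards [eventually_ge_atTop (({W f} : Finset A), 0)] with p hp
    rw [div_le_iff₀ (hcard p)]
    exact hfol p f (hp.1 (Finset.mem_singleton_self _))
  have hmult : ∀ a b, Tendsto (fun p => traceNorm₂ (φ p (a * b) - φ p a * φ p b)) atTop (𝓝 0) := by
    intro a b
    -- Density is needed only in the second factor, since the estimate on Weyl elements allows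
    -- arbitrary `a`.
    have h := tendsto_seminorm_zero_of_dense_span (l := atTop) (S := Set.range W) (C := 2 * ‖a‖)
      (fun p => (traceSeminorm (B p).card).comp (multiplicativityDefect (φ p).toLinearMap a))
      ?_ hW.dense_span ?_ b
    · simp only [Seminorm.comp_apply, traceSeminorm_apply] at h
      exact h
    · intro p c
      rw [Seminorm.comp_apply, traceSeminorm_apply]
      refine (traceNorm₂_le_norm _).trans ?_
      change ‖φ p (a * c) - φ p a * φ p c‖ ≤ _
      refine (norm_sub_le _ _).trans ?_
      have e1 := (hcontr p (a * c)).trans (norm_mul_le a c)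
      have e2 := (norm_mul_le (φ p a) (φ p c)).trans
        (mul_le_mul (hcontr p a) (hcontr p c) (norm_nonneg _) (norm_nonneg _))
      linarith
    · rintro _ ⟨f, rfl⟩
      simp only [Seminorm.comp_apply, traceSeminorm_apply]
      refine squeeze_zero (fun p => Real.sqrt_nonneg _)
        (fun p => hW.traceNorm₂_compressionMap_mul_weyl_le h1 h0 (B p) a f) ?_
      simpa using ((Real.continuous_sqrt.tendsto 0).comp (hratio f)).mul_const ‖a‖
  have hid : ∀ a, Tendsto (fun p => ‖reconstructionMap (w p) (φ p a) - a‖) atTop (𝓝 0) := by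
    intro a
    refine tendsto_seminorm_zero_of_dense_span (l := atTop) (S := Set.range W) (C := 2)
      (fun p => (normSeminorm ℂ A).comp
        (reconstructionMap (w p) ∘ₗ (φ p).toLinearMap - LinearMap.id)) ?_ hW.dense_span ?_ a
    · intro p c
      change ‖reconstructionMap (w p) (φ p c) - c‖ ≤ _
      refine (norm_sub_le _ _).trans ?_
      have := (hrec p (φ p c)).trans (hcontr p c)
      linarith
    · rintro _ ⟨f, rfl⟩
      exact squeeze_zero (fun p => norm_nonneg _)
        (fun p => hW.norm_reconstruction_compression_weyl_sub_le h1 h0 (hB p) f) (hratio f)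
  refine ⟨Finset A × ℕ, inferInstance, inferInstance, inferInstance, fun p => (B p).card, φ,
    fun p => (hB p).card_pos, hcontr, hmult, fun a => ?_⟩
  -- Both maps are contractive, so `‖φ p a‖` lies between the norm of its reconstruction, which
  -- tends to `‖a‖`, and `‖a‖`.
  have hlow := (hid a).const_sub ‖a‖
  rw [sub_zero] at hlow
  refine tendsto_of_tendsto_of_tendsto_of_le_of_le hlow tendsto_const_nhds (fun p => ?_)
    (fun p => hcontr p a)
  have e1 := norm_sub_norm_le a (a - reconstructionMap (w p) (φ p a))
  rw [sub_sub_cancel, norm_sub_rev a] at e1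
  exact e1.trans (hrec p (φ p a))

end IsWeylAlgebra

end

theorem mainTheorem1 {X : Type u} [AddCommGroup X] [Module ℝ X]
    (σ : LinearMap.BilinForm ℝ X) (hσ : σ.IsAlt) (hnd : σ.Nondegenerate)
    {A : Type v} [CStarAlgebra A] [PartialOrder A] [StarOrderedRing A]
    (W : X → A) (hW : IsWeylAlgebra σ W) :
    IsAlgebraicallyAmenable (weylStarAlgebra W) ∧
    (∀ (n : ℕ) (g : Fin n → X) (N : ℕ), 1 ≤ N →
      weylBoxSubspace W g N ≤ (weylStarAlgebra W).toSubalgebra.toSubmodule ∧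
      weylBoxSubspace W g N ≠ ⊥ ∧
      FiniteDimensional ℂ (weylBoxSubspace W g N) ∧
      ∀ i, (Module.finrank ℂ (mulAddSubspace (W (g i)) (weylBoxSubspace W g N)) : ℝ) ≤
        (1 + 1 / (N : ℝ)) * Module.finrank ℂ (weylBoxSubspace W g N)) ∧
    (∀ F : Finset A, (∀ a ∈ F, a ∈ weylStarAlgebra W) → ∀ ε : ℝ, 0 < ε →
      ∃ (n : ℕ) (g : Fin n → X) (N₀ : ℕ), ∀ N ≥ N₀, 1 ≤ N → ∀ a ∈ F,
        (Module.finrank ℂ (mulAddSubspace a (weylBoxSubspace W g N)) : ℝ) ≤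
          (1 + ε) * Module.finrank ℂ (weylBoxSubspace W g N)) ∧
    IsFolnerCStarAlgebra A := by
  exact ⟨hW.isAlgebraicallyAmenable hσ hnd,
    fun n g N hN => ⟨hW.weylBoxSubspace_le g N, hW.weylBoxSubspace_ne_bot hσ hnd g hN,
      finiteDimensional_weylBoxSubspace W g N,
      hW.finrank_mulAddSubspace_generator_le hσ hnd g hN⟩,
    fun F hF ε hε => hW.exists_box hσ hnd F hF hε,
    hW.isFolnerCStarAlgebra hσ hnd⟩
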